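/- Let $\mathbb{T}=\mathbb{R}/\mathbb{Z}$, let $\alpha\in\mathbb{R}$ be irrational, and let $\Psi:\mathbb{T}\to O(1)=\{\pm 1\}$ and $\rho:\mathbb{T}\to\mathbb{R}$ be continuous. Consider the one-dimensional cylindrical vortex $$F:\mathbb{T}\times\mathbb{R}\to\mathbb{T}\times\mathbb{R},\qquad F(x,v)=\big(x+\alpha,\ \Psi(x)v+\rho(x)\big).$$ Suppose that: (i) $F$ is almost-reducible, that is, there is a sequence of continuous functions $\varphi_k:\mathbb{T}\to\mathbb{R}$ with $$\lim_{k\to\infty}\ \sup_{x\in\mathbb{T}}\big|\rho(x)-[\varphi_k(x+\alpha)-\Psi(x)\varphi_k(x)]\big|=0;$$ (ii) $F$ is not reducible, that is, there is no continuous $\varphi:\mathbb{T}\to\mathbb{R}$ with $\varphi(x+\alpha)=\Psi(x)\varphi(x)+\rho(x)$ for all $x\in\mathbb{T}$; (iii) $\rho$ has finite total variation on $\mathbb{T}$. Then $F$ admits no nonempty, proper, minimal invariant closed set: there is no closed set $C$ with $\emptyset\neq C\subsetneq\mathbb{T}\times\mathbb{R}$ and $F(C)=C$ such that the only nonempty closed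 subset $D\subseteq C$ with $F(D)=D$ is $C$ itself. -/

import Mathlib

open Set Filter Topology

/-- A one-dimensional cylindrical vortex over `X`: a base homeomorphism `T` of `X`, a continuous
linear part `Ψ : X → O(1) = {1, -1}` (`unitary ℝ` is the group of real `u` with `u * u = 1`, with
the topology of `ℝ`), and a continuous translation part `ρ : X → ℝ`. -/
structure CylindricalVortex (X : Type*) [TopologicalSpace X] where
  T : X ≃ₜ X
  Ψ : C(X, unitary ℝ)
  ρ : C(X, ℝ)

namespace CylindricalVortex

variable {X : Type*} [TopologicalSpace X]

/-- The fibered map `(x, v) ↦ (T x, Ψ(x) v + ρ(x))`. -/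
def map (F : CylindricalVortex X) (p : X × ℝ) : X × ℝ :=
  (F.T p.1, (F.Ψ p.1 : ℝ) * p.2 + F.ρ p.1)

/-- There is a continuous invariant section, i.e. a continuous `φ` such that the fibered map
sends `(x, φ x)` to `(T x, φ (T x))` for all `x`. -/
def IsReducible (F : CylindricalVortex X) : Prop :=
  ∃ φ : C(X, ℝ), ∀ x, F.map (x, φ x) = (F.T x, φ (F.T x))

/-- There is an almost invariant sequence of continuous sections: the functions
`x ↦ φ_k (T x) - Ψ(x) φ_k(x)` converge to `ρ` uniformly on `X`. -/
def IsAlmostReducible (F : CylindricalVortex X) : Prop :=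
  ∃ φ : ℕ → C(X, ℝ),
    TendstoUniformly (fun k x => φ k (F.T x) - (F.Ψ x : ℝ) * φ k x) (fun x => F.ρ x) atTop

end CylindricalVortex

/-- `C` is minimal among the nonempty closed sets that are (two-sided) invariant under `f`. -/
def IsMinimalInvariantClosed {Y : Type*} [TopologicalSpace Y] (f : Y → Y) (C : Set Y) : Prop :=
  (C.Nonempty ∧ IsClosed C ∧ f '' C = C) ∧
    ∀ D : Set Y, D ⊆ C → D.Nonempty → IsClosed D → f '' D = D → D = C

/-- Finite total variation of a real function on the circle `ℝ / ℤ`. -/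
def HasFiniteTotalVariation (g : AddCircle (1 : ℝ) → ℝ) : Prop :=
  BoundedVariationOn (fun t : ℝ => g (t : AddCircle (1 : ℝ))) (Icc 0 1)

/-! The circle is connected, so `Ψ` is constantly `1` or `-1`.

If `Ψ = 1`, almost-reducibility forces `ρ` to have mean zero, and `denjoy_koksma` bounds its
Birkhoff sums `S_q` along denominators `q` of good approximations of `α`. For a minimal `C`, the
height differences within fibres of `C` form a closed subgroup of `ℝ`, the `verticalStabilizer`. If
it is dense, `C` is everything. Otherwise closedness of `C` forbids the Birkhoff sums at near-return
times from entering some annulus `r ≤ |s| ≤ r + B`. Two lengths `q`, `q'`, displacing the base point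
slightly in opposite directions, give a walk through near-return times with bounded gaps; its sums
change by at most `B` per step and cannot jump the annulus. So all Birkhoff sums at a point are
bounded, `C` is compact, and it is the graph of a continuous invariant section: a contradiction.

If `Ψ = -1`, then `F ∘ F` is a skew translation by `2α` with cocycle `ρ(x + α) - ρ(x)`, of mean
zero. A minimal set of `F` contains one of `F ∘ F`, and an invariant section of `F ∘ F` averages
with its image to one of `F`. -/

/-! ### Diophantine approximation from both sides. -/

/-- Every real number has coprime approximations `p / q` with `|q α - p|` less than `1 / q` and
arbitrarily small. -/
theorem exists_coprime_approx (α : ℝ) {ε : ℝ} (hε : 0 < ε) :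
    ∃ (q : ℕ) (p : ℤ), 0 < q ∧ IsCoprime p (q : ℤ) ∧ q * |q * α - p| < 1 ∧ |q * α - p| < ε := by
  obtain ⟨n, hn⟩ := exists_nat_one_div_lt hε
  -- Denominator at most `n + 1` and error at most `1 / (n + 2)` make the product strictly less than
  -- `1`.
  obtain ⟨r, hr, hd⟩ := Real.exists_rat_abs_sub_le_and_den_le α (Nat.succ_pos n)
  have hq : (0 : ℝ) < r.den := by exact_mod_cast r.den_pos
  have hn1 : (0 : ℝ) < (n : ℝ) + 1 := by positivity
  have key : |r.den * α - r.num| ≤ 1 / ((n : ℝ) + 1 + 1) := by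
    have : (r.den : ℝ) * α - r.num = r.den * (α - r) := by
      rw [mul_sub]
      congr 1
      exact_mod_cast (Rat.den_mul_eq_num r).symm
    rw [this, abs_mul, abs_of_pos hq]
    calc (r.den : ℝ) * |α - r| ≤ r.den * (1 / (((n.succ : ℕ) + 1) * r.den)) := by gcongr
      _ = _ := by push_cast; field_simp
  refine ⟨r.den, r.num, r.den_pos, Rat.isCoprime_num_den r, ?_, key.trans_lt (lt_trans ?_ hn)⟩
  · have hd' : (r.den : ℝ) ≤ n + 1 := by exact_mod_cast hd
    calc (r.den : ℝ) * |r.den * α - r.num| ≤ (n + 1) * (1 / ((n : ℝ) + 1 + 1)) := by gcongr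
      _ < 1 := by rw [mul_one_div, div_lt_one (by positivity)]; linarith
  · exact one_div_lt_one_div_of_lt hn1 (by linarith)

/-- Farey neighbours: from `a p + b q = 1`, the pairs `Q = -a + k q`, `P = b + k p` satisfy `q (Q α
- P) = Q θ - 1`. The largest `k` with `Q θ < 1` gives a nonpositive error of size at most `θ`. -/
theorem exists_approx_below {α : ℝ} {q : ℕ} {p : ℤ} (hq : 0 < q) (hc : IsCoprime p (q : ℤ))
    (h0 : 0 < q * α - p) (h1 : q * (q * α - p) < 1) :
    ∃ (q' : ℕ) (p' : ℤ), 0 < q' ∧ IsCoprime p' (q' : ℤ) ∧ q' * |q' * α - p'| < 1 ∧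
      q' * α - p' ≤ 0 ∧ |q' * α - p'| ≤ q * α - p := by
  set θ := q * α - p with hθ
  obtain ⟨a, b, hab⟩ := hc
  have hq' : (0 : ℝ) < q := by exact_mod_cast hq
  set k : ℤ := ⌈(1 / θ + a) / q⌉ - 1 with hk
  have hk1 : (k : ℝ) < (1 / θ + a) / q := by
    have := Int.ceil_lt_add_one ((1 / θ + a) / q)
    rw [hk]; push_cast; linarith
  have hk2 : (1 / θ + a) / q ≤ k + 1 := by
    have := Int.le_ceil ((1 / θ + a) / q)
    rw [hk]; push_cast; linarith
  rw [lt_div_iff₀ hq'] at hk1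
  rw [div_le_iff₀ hq'] at hk2
  set Q : ℤ := -a + k * q with hQ
  have hQr : (Q : ℝ) = -a + k * q := by rw [hQ]; push_cast; ring
  have hθi : 1 / θ * θ = 1 := by field_simp
  have hQ1 : Q * θ < 1 := by rw [hQr, ← hθi]; gcongr; linarith
  have hQ2 : 1 ≤ (Q + q) * θ := by rw [hQr, ← hθi]; gcongr; linarith
  have hQpos : 0 < Q := by
    have : (0 : ℝ) < Q := by
      by_contra! h
      nlinarith
    exact_mod_cast this
  obtain ⟨n, hn⟩ := Int.eq_ofNat_of_zero_le hQpos.le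
  have hnr : (n : ℝ) = Q := by rw [hn]; simp
  have habr : (a : ℝ) * p + b * q = 1 := by exact_mod_cast hab
  have hval : q * ((Q : ℝ) * α - (b + k * p : ℤ)) = Q * θ - 1 := by
    rw [hθ, hQr]; push_cast; linear_combination (-1 : ℝ) * habr
  have hle : (Q : ℝ) * α - (b + k * p : ℤ) ≤ 0 := by
    by_contra! h
    nlinarith
  have habs : |(Q : ℝ) * α - (b + k * p : ℤ)| ≤ θ := by
    rw [abs_of_nonpos hle]
    have : q * (-((Q : ℝ) * α - (b + k * p : ℤ))) ≤ q * θ := by linarith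
    exact le_of_mul_le_mul_left this hq'
  have hQr0 : (0 : ℝ) < Q := by exact_mod_cast hQpos
  refine ⟨n, b + k * p, by omega, ⟨q, -p, ?_⟩, ?_, ?_, ?_⟩
  · have hn' : (n : ℤ) = Q := hn.symm
    rw [hn', hQ]; linear_combination hab
  · rw [hnr]
    exact (mul_le_mul_of_nonneg_left habs hQr0.le).trans_lt hQ1
  · rw [hnr]; exact hle
  · rw [hnr]; exact habs

/-- Coprime approximations of quality `1 / q` exist on both sides. -/
theorem exists_coprime_approx_two_sided {α : ℝ} (hα : Irrational α) {ε : ℝ} (hε : 0 < ε) :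
    ∃ (q q' : ℕ) (p p' : ℤ), 0 < q ∧ 0 < q' ∧ IsCoprime p (q : ℤ) ∧ IsCoprime p' (q' : ℤ) ∧
      q * |q * α - p| < 1 ∧ q' * |q' * α - p'| < 1 ∧
      0 ≤ q * α - p ∧ q * α - p < ε ∧ q' * α - p' ≤ 0 ∧ -ε < q' * α - p' := by
  obtain ⟨q, p, hq, hc, h1, h2⟩ := exists_coprime_approx α hε
  rcases lt_trichotomy (q * α - p) 0 with h | h | h
  · have hneg : (q : ℝ) * (-α) - (-p : ℤ) = |q * α - p| := by
      rw [abs_of_neg h]; push_cast; ring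
    obtain ⟨q', p', a1, a2, a3, a4, a5⟩ := exists_approx_below (α := -α) (p := -p) hq hc.neg_left
      (by rw [hneg]; exact abs_pos.2 h.ne) (by rw [hneg]; exact h1)
    have e : (q' : ℝ) * (-α) - p' = -(q' * α - (-p' : ℤ)) := by push_cast; ring
    rw [e] at a3 a4 a5
    rw [abs_neg] at a3 a5
    rw [hneg] at a5
    refine ⟨q', q, -p', p, a1, hq, a2.neg_left, hc, a3, h1, by linarith, ?_, h.le, ?_⟩
    · exact (le_abs_self _).trans_lt (a5.trans_lt h2)
    · exact (abs_lt.1 h2).1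
  · exfalso
    refine (Irrational.ne_int (hα.natCast_mul hq.ne') p) (by linarith)
  · obtain ⟨q', p', a1, a2, a3, a4, a5⟩ := exists_approx_below (α := α) (p := p) hq hc h
      (by rwa [abs_of_pos h] at h1)
    refine ⟨q, q', p, p', hq, a1, hc, a2, h1, a3, h.le, (abs_lt.1 h2).2, a4, ?_⟩
    have := neg_abs_le ((q' : ℝ) * α - p')
    have := (abs_lt.1 h2).2
    linarith

/-! ### The Denjoy-Koksma inequality. -/

theorem Finset.sum_range_mul_emod {q : ℕ} (hq : 0 < q) {u : ℤ} (hu : IsCoprime u (q : ℤ))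
    (g : ℕ → ℝ) :
    ∑ j ∈ Finset.range q, g j = ∑ i ∈ Finset.range q, g ((i * u) % q).toNat := by
  have hq' : (0 : ℤ) < q := by exact_mod_cast hq
  have hmaps : ∀ i ∈ Finset.range q, ((i * u) % q).toNat ∈ Finset.range q := by
    intro i _
    have := Int.emod_lt_of_pos (i * u) hq'
    have := Int.emod_nonneg (i * u) hq'.ne'
    rw [Finset.mem_range]; omega
  have hinj : Set.InjOn (fun i : ℕ => ((i * u) % q).toNat) (Finset.range q) := by
    intro i hi j hj hij
    have h1 := Int.emod_nonneg (i * u) hq'.ne'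
    have h2 := Int.emod_nonneg (j * u) hq'.ne'
    have h3 : (i * u) % (q : ℤ) = (j * u) % q := by
      have : ((i * u) % (q : ℤ)).toNat = ((j * u) % (q : ℤ)).toNat := hij
      omega
    have h4 : (q : ℤ) ∣ (i - j) * u := by
      rw [sub_mul]; exact Int.ModEq.dvd h3.symm
    have h5 : (q : ℤ) ∣ i - j := hu.symm.dvd_of_dvd_mul_right h4
    simp only [Finset.coe_range, Set.mem_Iio] at hi hj
    have h6 := Int.eq_zero_of_abs_lt_dvd h5 (by rw [abs_lt]; omega)
    omega
  refine (Finset.sum_nbij (fun i : ℕ => ((i * u) % q).toNat) hmaps hinj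
    (Finset.surjOn_of_injOn_of_card_le _ hmaps hinj le_rfl) fun _ _ => rfl).symm

/-- With one sample in each interval of length `1 / q`, a sample differs from the mean over its
interval by at most the variation there, and these variations add up. -/
theorem abs_sum_sub_mul_integral_le {f : ℝ → ℝ} (hf : Continuous f) {a B : ℝ} (hB : 0 ≤ B)
    (hV : eVariationOn f (Icc a (a + 1)) ≤ ENNReal.ofReal B) {q : ℕ} (hq : 0 < q) {y : ℕ → ℝ}
    (hy : ∀ i < q, y i ∈ Icc (a + i / q) (a + (i + 1) / q)) :
    |∑ i ∈ Finset.range q, f (y i) - q * ∫ t in a..a + 1, f t| ≤ B := by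
  have hq' : (0 : ℝ) < q := by exact_mod_cast hq
  set I : ℕ → ℝ := fun i => a + i / q with hI
  have hIs : ∀ i, I (i + 1) = a + (i + 1) / q := fun i => by simp [hI]
  have hmono : Monotone I := by
    intro i j hij
    simp only [hI]; gcongr
  have hIq : I q = a + 1 := by simp [hI, hq'.ne']
  have hI0 : I 0 = a := by simp [hI]
  have hsum := eVariationOn.sum' f hmono (n := q)
  rw [hIq, hI0] at hsum
  rw [← hsum] at hV
  have hfin : ∀ i ∈ Finset.range q, eVariationOn f (Icc (I i) (I (i + 1))) ≠ ⊤ := fun i hi =>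
    ((Finset.single_le_sum (f := fun i => eVariationOn f (Icc (I i) (I (i + 1))))
      (fun _ _ => zero_le) hi).trans hV).trans_lt ENNReal.ofReal_lt_top |>.ne
  have hV' : ∑ i ∈ Finset.range q, (eVariationOn f (Icc (I i) (I (i + 1)))).toReal ≤ B := by
    rw [← ENNReal.toReal_sum hfin]
    exact ENNReal.toReal_le_of_le_ofReal hB hV
  have hint : ∫ t in a..a + 1, f t = ∑ i ∈ Finset.range q, ∫ t in I i..I (i + 1), f t := by
    rw [intervalIntegral.sum_integral_adjacent_intervals
      (fun k _ => hf.intervalIntegrable _ _), hIq, hI0]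
  rw [hint, Finset.mul_sum, ← Finset.sum_sub_distrib]
  refine (Finset.abs_sum_le_sum_abs _ _).trans ((Finset.sum_le_sum fun i hi => ?_).trans hV')
  have hlen : I (i + 1) - I i = 1 / q := by rw [hIs]; simp only [hI]; ring
  have hle : I i ≤ I (i + 1) := hmono (Nat.le_succ i)
  have e : f (y i) - q * ∫ t in I i..I (i + 1), f t
      = q * ∫ t in I i..I (i + 1), (f (y i) - f t) := by
    rw [intervalIntegral.integral_sub intervalIntegrable_const (hf.intervalIntegrable _ _),
      intervalIntegral.integral_const, hlen, smul_eq_mul, mul_sub]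
    field_simp
  have hb : ‖∫ t in I i..I (i + 1), (f (y i) - f t)‖
      ≤ (eVariationOn f (Icc (I i) (I (i + 1)))).toReal * |I (i + 1) - I i| := by
    refine intervalIntegral.norm_integral_le_of_norm_le_const fun t ht => ?_
    rw [uIoc_of_le hle] at ht
    rw [Real.norm_eq_abs, ← Real.dist_eq]
    refine BoundedVariationOn.dist_le (hfin i hi) ?_ (Ioc_subset_Icc_self ht)
    have := hy i (Finset.mem_range.1 hi)
    rwa [← hIs] at this
  rw [e, abs_mul, abs_of_pos hq']
  rw [hlen, abs_of_pos (by positivity), Real.norm_eq_abs] at hb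
  calc q * |∫ t in I i..I (i + 1), (f (y i) - f t)|
      ≤ q * ((eVariationOn f (Icc (I i) (I (i + 1)))).toReal * (1 / q)) := by gcongr
    _ = _ := by field_simp

/-- A periodic function of bounded variation over one period has uniformly bounded variation over
all intervals of the length of a period. -/
theorem HasFiniteTotalVariation.exists_bound {g : AddCircle (1 : ℝ) → ℝ}
    (hg : HasFiniteTotalVariation g) :
    ∃ B : ℝ, 0 ≤ B ∧ ∀ a : ℝ, eVariationOn (fun t : ℝ => g t) (Icc a (a + 1)) ≤
      ENNReal.ofReal B := by
  set f : ℝ → ℝ := fun t : ℝ => g t with hf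
  have hper : ∀ n : ℤ, eVariationOn f (Icc (n : ℝ) (n + 1)) = eVariationOn f (Icc 0 1) := by
    intro n
    have h := eVariationOn.comp_eq_of_monotoneOn f (t := Icc (0 : ℝ) 1) (fun t => t + n)
      (fun x _ y _ hxy => by simpa using hxy)
    rw [Set.image_add_const_Icc, zero_add, add_comm 1] at h
    rw [← h]
    congr 1
    ext t
    simp [hf]
  refine ⟨2 * (eVariationOn f (Icc 0 1)).toReal, by positivity, fun a => ?_⟩
  have hsub : Icc a (a + 1) ⊆ Icc (⌊a⌋ : ℝ) (⌊a⌋ + 2) :=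
    Icc_subset_Icc (Int.floor_le a) (by linarith [Int.lt_floor_add_one a])
  refine (eVariationOn.mono f hsub).trans ?_
  have hadd := eVariationOn.Icc_add_Icc f (s := univ) (a := (⌊a⌋ : ℝ)) (b := ⌊a⌋ + 1) (c := ⌊a⌋ + 2)
    (by linarith) (by linarith) (mem_univ _)
  simp only [univ_inter] at hadd
  have h2 := hper (⌊a⌋ + 1)
  push_cast at h2
  rw [add_assoc, one_add_one_eq_two] at h2
  rw [← hadd, hper, h2, two_mul, ENNReal.ofReal_add (by positivity) (by positivity),
    ENNReal.ofReal_toReal hg]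

theorem iterate_add_right_apply {G : Type*} [AddMonoid G] (a : G) (n : ℕ) (x : G) :
    (fun y => y + a)^[n] x = x + n • a := by
  simp

/-- The **Denjoy-Koksma inequality**. -/
theorem denjoy_koksma (α : ℝ) {g : AddCircle (1 : ℝ) → ℝ} (hc : Continuous g)
    (hg : HasFiniteTotalVariation g) :
    ∃ B : ℝ, 0 ≤ B ∧ ∀ (q : ℕ) (p : ℤ), 0 < q → IsCoprime p (q : ℤ) → q * |q * α - p| < 1 →
      ∀ x, |birkhoffSum (fun y => y + (α : AddCircle (1 : ℝ))) g q x - q * ∫ y, g y| ≤ B := by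
  obtain ⟨B, hB, hV⟩ := hg.exists_bound
  refine ⟨B, hB, fun q p hq hpq hθ x => ?_⟩
  obtain ⟨t, rfl⟩ := QuotientAddGroup.mk_surjective x
  have hq' : (0 : ℝ) < q := by exact_mod_cast hq
  have hqz : (0 : ℤ) < q := by exact_mod_cast hq
  obtain ⟨u, b, hub⟩ := hpq
  have hu : IsCoprime u (q : ℤ) := ⟨p, b, by linear_combination hub⟩
  set θ := q * α - p with hθdef
  set f : ℝ → ℝ := fun t => g t with hf
  have hfc : Continuous f := hc.comp (AddCircle.continuous_mk' 1)
  -- As `u` inverts `p` modulo `q`, the orbit point of index `σ i` is `t + i / q + σ i * (θ / q)`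
  -- modulo `1`, within `1 / q` of `t + i / q`.
  set σ : ℕ → ℕ := fun i => ((i * u) % (q : ℤ)).toNat with hσ
  have hσq : ∀ i, (σ i : ℝ) ≤ q := fun i => by
    have := Int.emod_lt_of_pos (i * u) hqz
    have : σ i ≤ q := by simp only [hσ]; omega
    exact_mod_cast this
  have hsum : birkhoffSum (fun y => y + (α : AddCircle (1 : ℝ))) g q (t : AddCircle (1 : ℝ))
      = ∑ i ∈ Finset.range q, f (t + i / q + σ i * (θ / q)) := by
    rw [birkhoffSum, Finset.sum_range_mul_emod hq hu]
    refine Finset.sum_congr rfl fun i _ => ?_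
    rw [iterate_add_right_apply]
    change g _ = g _
    congr 1
    have h1 : ((σ i : ℕ) : ℤ) = (i * u) % q := by
      simp only [hσ]; exact Int.toNat_of_nonneg (Int.emod_nonneg _ hqz.ne')
    have h2 : (σ i : ℤ) * p = i + q * (-(i * b) - (i * u) / q * p) := by
      have h3 := Int.emod_add_mul_ediv (i * u) (q : ℤ)
      rw [← h1] at h3
      linear_combination p * h3 + (i : ℤ) * hub
    have h2r : (σ i : ℝ) * p = i + q * ((-(i * b) - (i * u) / q * p : ℤ) : ℝ) := by
      exact_mod_cast h2
    set m : ℤ := -(i * b) - (i * u) / q * p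
    have hm : ((m : ℝ) : AddCircle (1 : ℝ)) = 0 :=
      (AddCircle.coe_eq_zero_iff 1).2 ⟨m, by simp⟩
    have h4 : t + i / q + σ i * (θ / q) = t + σ i * α - (m : ℝ) := by
      rw [hθdef]
      field_simp
      linear_combination -h2r
    rw [h4]
    change (t : AddCircle (1 : ℝ)) + (σ i) • (α : AddCircle (1 : ℝ)) = _
    rw [AddCircle.coe_sub, AddCircle.coe_add, ← nsmul_eq_mul, AddCircle.coe_nsmul, hm,
      sub_zero]
  have hint : ∀ a : ℝ, ∫ y, g y = ∫ s in a..a + 1, f s := fun a =>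
    (UnitAddCircle.intervalIntegral_preimage a g).symm
  change |birkhoffSum (fun y => y + (α : AddCircle (1 : ℝ))) g q (t : AddCircle (1 : ℝ)) - _| ≤ B
  have hθb := abs_le.1 ((le_div_iff₀' hq').2 hθ.le)
  have hmul : ∀ i, |σ i * (θ / q)| ≤ 1 / q := fun i => by
    rw [abs_mul, abs_div, Nat.abs_cast, Nat.abs_cast]
    calc (σ i : ℝ) * (|θ| / q) ≤ q * (|θ| / q) := by gcongr; exact_mod_cast hσq i
      _ = |θ| := by field_simp
      _ ≤ 1 / q := (le_div_iff₀' hq').2 hθ.le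
  rw [hsum]
  -- All displacements have the sign of `θ`, so the partition starts at `t` or at `t - 1 / q`.
  rcases le_total 0 θ with h | h
  · rw [hint t]
    refine abs_sum_sub_mul_integral_le hfc hB (hV t) hq fun i _ => ?_
    have h0 : 0 ≤ σ i * (θ / q) := by positivity
    have h1 := (abs_le.1 (hmul i)).2
    rw [add_div]
    constructor <;> linarith
  · rw [hint (t - 1 / q)]
    refine abs_sum_sub_mul_integral_le hfc hB (hV _) hq fun i _ => ?_
    have h0 : σ i * (θ / q) ≤ 0 :=
      mul_nonpos_of_nonneg_of_nonpos (by positivity) (div_nonpos_of_nonpos_of_nonneg h hq'.le)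
    have h1 := (abs_le.1 (hmul i)).1
    rw [add_div]
    constructor <;> linarith

/-! ### Minimal sets, skew translations and vertical stabilizers. -/

theorem Function.Bijective.image_eq_self_iff {Y : Type*} {f : Y → Y} (hf : Function.Bijective f)
    {D : Set Y} : f '' D = D ↔ ∀ p, f p ∈ D ↔ p ∈ D := by
  constructor
  · intro h p
    nth_rewrite 1 [← h]
    exact hf.1.mem_set_image
  · intro h
    ext y
    obtain ⟨p, rfl⟩ := hf.2 y
    rw [hf.1.mem_set_image, h]

/-- A minimal invariant closed set with a forward orbit in a compact set `K` lies in `K`. -/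
theorem IsMinimalInvariantClosed.subset_of_forward_orbit {Y : Type*} [TopologicalSpace Y]
    [T2Space Y] {f : Y ≃ₜ Y} {C K : Set Y} (hC : IsMinimalInvariantClosed f C) (hK : IsCompact K)
    {p : Y} (hp : p ∈ C) (horb : ∀ n : ℕ, f^[n] p ∈ K) : C ⊆ K := by
  obtain ⟨⟨-, hCc, hCi⟩, hmin⟩ := hC
  have hpC : ∀ n : ℕ, f^[n] p ∈ C := fun n => by
    induction n with
    | zero => exact hp
    | succ n ih =>
      rw [Function.iterate_succ_apply']
      exact (f.bijective.image_eq_self_iff.1 hCi _).2 ih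
  -- The intersection of the `A n` is the ω-limit set, which is two-sided invariant, while `A 0`
  -- need only be forward invariant.
  set A : ℕ → Set Y := fun n => closure ((fun k => f^[k] p) '' Ici n) with hA
  have hAK : ∀ n, A n ⊆ K := fun n =>
    closure_minimal (by rintro _ ⟨k, -, rfl⟩; exact horb k) hK.isClosed
  have hAC : ∀ n, A n ⊆ C := fun n =>
    closure_minimal (by rintro _ ⟨k, -, rfl⟩; exact hpC k) hCc
  have hanti : ∀ n, A (n + 1) ⊆ A n := fun n =>
    closure_mono (image_mono (Ici_subset_Ici.2 (Nat.le_succ n)))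
  have hAf : ∀ n, f '' A n = A (n + 1) := fun n => by
    simp only [hA]
    rw [f.image_closure, ← image_comp]
    congr 1
    ext y
    constructor
    · rintro ⟨k, hk, rfl⟩
      exact ⟨k + 1, Nat.succ_le_succ hk, Function.iterate_succ_apply' _ _ _⟩
    · rintro ⟨k, hk, rfl⟩
      obtain ⟨j, rfl⟩ : ∃ j, k = j + 1 := ⟨k - 1, by simp only [mem_Ici] at hk; omega⟩
      exact ⟨j, Nat.succ_le_succ_iff.1 hk, (Function.iterate_succ_apply' _ _ _).symm⟩
  have hne : (⋂ n, A n).Nonempty :=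
    IsCompact.nonempty_iInter_of_sequence_nonempty_isCompact_isClosed A hanti
      (fun n => ⟨_, subset_closure ⟨n, self_mem_Ici, rfl⟩⟩)
      (hK.of_isClosed_subset isClosed_closure (hAK 0)) (fun _ => isClosed_closure)
  have hD := hmin (⋂ n, A n) ((iInter_subset A 0).trans (hAC 0)) hne
    (isClosed_iInter fun _ => isClosed_closure) (by
      rw [image_iInter f.bijective]
      simp only [hAf]
      exact Subset.antisymm (iInter_mono hanti)
        (subset_iInter fun n => iInter_subset A (n + 1)))
  rw [← hD]
  exact (iInter_subset A 0).trans (hAK 0)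

/-- The skew translation `(x, v) ↦ (x + a, v + ρ x)`. -/
def skewTranslation (a : AddCircle (1 : ℝ)) (ρ : C(AddCircle (1 : ℝ), ℝ)) :
    AddCircle (1 : ℝ) × ℝ ≃ₜ AddCircle (1 : ℝ) × ℝ where
  toFun p := (p.1 + a, p.2 + ρ p.1)
  invFun p := (p.1 - a, p.2 - ρ (p.1 - a))
  left_inv p := by simp
  right_inv p := by simp
  continuous_toFun := by fun_prop
  continuous_invFun := by fun_prop

section

variable {a : AddCircle (1 : ℝ)} {ρ : C(AddCircle (1 : ℝ), ℝ)} {C : Set (AddCircle (1 : ℝ) × ℝ)}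

theorem skewTranslation_apply (x : AddCircle (1 : ℝ)) (v : ℝ) :
    skewTranslation a ρ (x, v) = (x + a, v + ρ x) := rfl

theorem skewTranslation_iterate (n : ℕ) (x : AddCircle (1 : ℝ)) (v : ℝ) :
    (skewTranslation a ρ)^[n] (x, v) = (x + n • a, v + birkhoffSum (fun y => y + a) ρ n x) := by
  induction n with
  | zero => simp
  | succ n ih =>
    rw [Function.iterate_succ_apply', ih, skewTranslation_apply, birkhoffSum_succ,
      iterate_add_right_apply, succ_nsmul, add_assoc, add_assoc]

theorem skewTranslation_mem_iff (hC : skewTranslation a ρ '' C = C) (x : AddCircle (1 : ℝ))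
    (v : ℝ) : (x + a, v + ρ x) ∈ C ↔ (x, v) ∈ C :=
  (skewTranslation a ρ).bijective.image_eq_self_iff.1 hC (x, v)

theorem skewTranslation_iterate_mem (hC : skewTranslation a ρ '' C = C) {x : AddCircle (1 : ℝ)}
    {v : ℝ} (h : (x, v) ∈ C) (n : ℕ) :
    (x + n • a, v + birkhoffSum (fun y => y + a) ρ n x) ∈ C := by
  rw [← skewTranslation_iterate]
  induction n with
  | zero => exact h
  | succ n ih =>
    rw [Function.iterate_succ_apply']
    exact ((skewTranslation a ρ).bijective.image_eq_self_iff.1 hC _).2 ih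

/-- The group of vertical translations that preserve `C`. -/
def verticalStabilizer (C : Set (AddCircle (1 : ℝ) × ℝ)) : AddSubgroup ℝ where
  carrier := {s | ∀ x v, (x, v + s) ∈ C ↔ (x, v) ∈ C}
  zero_mem' := by simp
  add_mem' {s t} hs ht x v := by rw [← add_assoc, ht, hs]
  neg_mem' {s} hs x v := by rw [← hs, neg_add_cancel_right]

/-- Vertical translations commute with the skew translation, so the points of `C` that stay in `C`
after a shift by `s` form a closed invariant subset. -/
theorem IsMinimalInvariantClosed.add_mem (hC : IsMinimalInvariantClosed (skewTranslation a ρ) C)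
    {x : AddCircle (1 : ℝ)} {v s : ℝ} (h : (x, v) ∈ C) (hs : (x, v + s) ∈ C)
    {y : AddCircle (1 : ℝ)} {w : ℝ} (hy : (y, w) ∈ C) : (y, w + s) ∈ C := by
  obtain ⟨⟨-, hCc, hCi⟩, hmin⟩ := hC
  have hD := hmin (C ∩ {p | (p.1, p.2 + s) ∈ C}) inter_subset_left ⟨(x, v), h, hs⟩
    (hCc.inter (hCc.preimage (by fun_prop))) (by
      rw [(skewTranslation a ρ).bijective.image_eq_self_iff]
      rintro ⟨y, w⟩
      simp only [skewTranslation_apply, mem_inter_iff, mem_ofPred_eq,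
        skewTranslation_mem_iff hCi, add_right_comm w (ρ y) s])
  rw [← hD] at hy
  exact hy.2

theorem IsMinimalInvariantClosed.mem_verticalStabilizer
    (hC : IsMinimalInvariantClosed (skewTranslation a ρ) C) {x : AddCircle (1 : ℝ)} {v s : ℝ}
    (h : (x, v) ∈ C) (hs : (x, v + s) ∈ C) : s ∈ verticalStabilizer C := by
  refine fun y w => ⟨fun hy => ?_, fun hy => hC.add_mem h hs hy⟩
  have := hC.add_mem (s := -s) hs (by simpa using h) hy
  simpa using this

theorem isClosed_verticalStabilizer (hC : IsMinimalInvariantClosed (skewTranslation a ρ) C) :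
    IsClosed (verticalStabilizer C : Set ℝ) := by
  obtain ⟨⟨x, v⟩, hx⟩ := hC.1.1
  have : (verticalStabilizer C : Set ℝ) = (fun s => (x, v + s)) ⁻¹' C := by
    ext s
    exact ⟨fun h => (h x v).2 hx, fun h => hC.mem_verticalStabilizer hx h⟩
  rw [this]
  exact hC.1.2.1.preimage (by fun_prop)

theorem eq_univ_of_forall_add_mem_iff {α : ℝ} (hα : Irrational α) {E : Set (AddCircle (1 : ℝ))}
    (hne : E.Nonempty) (hc : IsClosed E) (h : ∀ x, x + (α : AddCircle (1 : ℝ)) ∈ E ↔ x ∈ E) :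
    E = univ := by
  obtain ⟨x, hx⟩ := hne
  have hd : DenseRange (fun n : ℤ => n • (α : AddCircle (1 : ℝ))) :=
    AddCircle.denseRange_zsmul_coe_iff.2 (by simpa using hα)
  have horb : ∀ n : ℤ, n • (α : AddCircle (1 : ℝ)) ∈ (fun y => x + y) ⁻¹' E := fun n => by
    induction n using Int.induction_on with
    | zero => simpa using hx
    | succ n ih =>
      have := (h _).2 ih
      rwa [add_assoc, ← add_one_zsmul] at this
    | pred n ih =>
      refine (h _).1 ?_
      rwa [add_assoc, ← add_one_zsmul, sub_add_cancel]
  have hcl : IsClosed ((fun y => x + y) ⁻¹' E) := hc.preimage (by fun_prop)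
  have huniv : (fun y => x + y) ⁻¹' E = univ :=
    univ_subset_iff.1 (hd.closure_eq ▸ closure_minimal (range_subset_iff.2 horb) hcl)
  refine eq_univ_of_forall fun y => ?_
  have : y - x ∈ (fun y => x + y) ⁻¹' E := huniv ▸ mem_univ _
  simpa using this

/-! ### From gaps in the returns to bounded sums and invariant sections. -/

/-- Suppose `q α` and `q' α` are close to `0` modulo `1` from above and from below, and that the
Birkhoff sums of lengths `q` and `q'` are at most `B`. If no Birkhoff sum at `x` along a return of
`x` to itself up to `ε` has its absolute value in `[r, r + B]`, then all Birkhoff sums at `x` are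
bounded. -/
theorem exists_forall_abs_birkhoffSum_le {α : ℝ} (ρ : C(AddCircle (1 : ℝ), ℝ))
    (x : AddCircle (1 : ℝ)) {r B ε : ℝ} (hr : 0 < r) (hε : 0 ≤ ε) {q q' : ℕ} {p p' : ℤ}
    (hq : 0 < q) (hq' : 0 < q') (h1 : 0 ≤ q * α - p) (h2 : q * α - p ≤ ε) (h3 : q' * α - p' ≤ 0)
    (h4 : -ε ≤ q' * α - p')
    (hB : ∀ y, |birkhoffSum (fun y => y + (α : AddCircle (1 : ℝ))) ρ q y| ≤ B)
    (hB' : ∀ y, |birkhoffSum (fun y => y + (α : AddCircle (1 : ℝ))) ρ q' y| ≤ B)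
    (hgap : ∀ (n : ℕ) (m : ℤ), |n * α - m| ≤ ε →
      ¬ (r ≤ |birkhoffSum (fun y => y + (α : AddCircle (1 : ℝ))) ρ n x| ∧
        |birkhoffSum (fun y => y + (α : AddCircle (1 : ℝ))) ρ n x| ≤ r + B)) :
    ∃ K, ∀ n, |birkhoffSum (fun y => y + (α : AddCircle (1 : ℝ))) ρ n x| ≤ K := by
  set S := fun n => birkhoffSum (fun y => y + (α : AddCircle (1 : ℝ))) ρ n x with hS
  have hnext : ∀ (n : ℕ) (m : ℤ), |n * α - m| ≤ ε → |S n| < r →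
      ∃ (d : ℕ) (m' : ℤ), 0 < d ∧ d ≤ q + q' ∧ |(n + d : ℕ) * α - m'| ≤ ε ∧ |S (n + d)| < r := by
    intro n m hn hSn
    have hstep : ∀ d : ℕ, ∀ m' : ℤ,
        (∀ y, |birkhoffSum (fun y => y + (α : AddCircle (1 : ℝ))) ρ d y| ≤ B) →
        |(n + d : ℕ) * α - m'| ≤ ε → |S (n + d)| < r := by
      intro d m' hd hm'
      have e : S (n + d) = S n + _ := birkhoffSum_add _ _ n d x
      have hle : |S (n + d)| ≤ r + B := by
        rw [e]
        exact (abs_add_le _ _).trans (add_le_add hSn.le (hd _))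
      by_contra! hcon
      exact hgap _ _ hm' ⟨hcon, hle⟩
    rw [abs_le] at hn
    -- Stepping against the sign of the current displacement keeps it within `ε`.
    rcases le_total (n * α - m) 0 with h | h
    · have hm' : |((n + q : ℕ) : ℝ) * α - (m + p : ℤ)| ≤ ε := by
        rw [abs_le]; push_cast; constructor <;> linarith
      exact ⟨q, m + p, hq, by omega, hm', hstep _ _ hB hm'⟩
    · have hm' : |((n + q' : ℕ) : ℝ) * α - (m + p' : ℤ)| ≤ ε := by
        rw [abs_le]; push_cast; constructor <;> linarith
      exact ⟨q', m + p', hq', by omega, hm', hstep _ _ hB' hm'⟩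
  have hwalk : ∀ k : ℕ, ∃ (n : ℕ) (m : ℤ),
      n ≤ k ∧ k < n + (q + q') ∧ |n * α - m| ≤ ε ∧ |S n| < r := by
    intro k
    induction k with
    | zero => exact ⟨0, 0, le_rfl, by omega, by simpa using hε, by simpa [hS] using hr⟩
    | succ k ih =>
      obtain ⟨n, m, hnk, hkn, hn, hSn⟩ := ih
      by_cases hlt : k + 1 < n + (q + q')
      · exact ⟨n, m, by omega, hlt, hn, hSn⟩
      · obtain ⟨d, m', hd0, hd, hm', hS'⟩ := hnext n m hn hSn
        exact ⟨n + d, m', by omega, by omega, hm', hS'⟩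
  -- Every time lies fewer than `q + q'` steps after a near-return time of the walk.
  refine ⟨r + (q + q') * ‖ρ‖, fun k => ?_⟩
  obtain ⟨n, m, hnk, hkn, -, hSn⟩ := hwalk k
  obtain ⟨d, rfl⟩ := Nat.exists_eq_add_of_le hnk
  rw [birkhoffSum_add]
  refine (abs_add_le _ _).trans (add_le_add hSn.le ?_)
  rw [birkhoffSum]
  refine (Finset.abs_sum_le_sum_abs _ _).trans ((Finset.sum_le_card_nsmul _ _ ‖ρ‖
    fun i _ => ρ.norm_coe_le_norm _).trans ?_)
  rw [Finset.card_range, nsmul_eq_mul]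
  gcongr
  exact_mod_cast (by omega : d ≤ q + q')

/-- By compactness, a set of height differences missing from the fibres of `C` is still missing
between slightly displaced fibres. -/
theorem exists_forall_add_notMem (hC : IsClosed C) {Q : Set (AddCircle (1 : ℝ) × ℝ)}
    (hQ : IsCompact Q) {A : Set ℝ} (hA : IsCompact A)
    (h : ∀ x v, (x, v) ∈ Q → ∀ s ∈ A, (x, v + s) ∉ C) :
    ∃ ε > 0, ∀ θ : ℝ, |θ| ≤ ε → ∀ x v, (x, v) ∈ Q → ∀ s ∈ A, (x + θ, v + s) ∉ C := by
  set g : ℝ × ((AddCircle (1 : ℝ) × ℝ) × ℝ) → AddCircle (1 : ℝ) × ℝ :=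
    fun z => (z.2.1.1 + (z.1 : AddCircle (1 : ℝ)), z.2.1.2 + z.2.2) with hg
  have hgc : Continuous g := by
    have := (AddCircle.continuous_mk' (1 : ℝ)).comp
      (continuous_fst : Continuous fun z : ℝ × ((AddCircle (1 : ℝ) × ℝ) × ℝ) => z.1)
    exact ((continuous_fst.comp (continuous_fst.comp continuous_snd)).add this).prodMk
      (by fun_prop)
  obtain ⟨u, w, hu, -, h0, hw, huw⟩ := generalized_tube_lemma (isCompact_singleton (x := (0 : ℝ)))
    (hQ.prod hA) (hC.isOpen_compl.preimage hgc) (by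
      rintro ⟨θ, ⟨x, v⟩, s⟩ ⟨hθ, hxv, hs⟩
      obtain rfl : θ = 0 := hθ
      simpa [hg] using h x v hxv s hs)
  obtain ⟨ε, hε, hball⟩ := Metric.nhds_basis_closedBall.mem_iff.1
    (hu.mem_nhds (h0 (mem_singleton _)))
  refine ⟨ε, hε, fun θ hθ x v hxv s hs => ?_⟩
  exact huw (⟨hball (by simpa using hθ), hw ⟨hxv, hs⟩⟩ : (θ, (x, v), s) ∈ u ×ˢ w)

/-- Each fibre of `C` is a single point, and a compact graph belongs to a continuous function. -/
theorem exists_invariant_section {α : ℝ} (hα : Irrational α)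
    (hC : IsMinimalInvariantClosed (skewTranslation α ρ) C) (hcomp : IsCompact C)
    (hstab : ∀ s ∈ verticalStabilizer C, s = 0) :
    ∃ φ : C(AddCircle (1 : ℝ), ℝ), ∀ x, φ (x + α) = φ x + ρ x := by
  have hproj : Prod.fst '' C = univ := by
    refine eq_univ_of_forall_add_mem_iff hα (hC.1.1.image _)
      (hcomp.image continuous_fst).isClosed fun x => ?_
    constructor
    · rintro ⟨⟨_, v⟩, hy, rfl⟩
      exact ⟨(x, v - ρ x), (skewTranslation_mem_iff hC.1.2.2 _ _).1 (by simpa using hy), rfl⟩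
    · rintro ⟨⟨y, v⟩, hy, rfl⟩
      exact ⟨_, (skewTranslation_mem_iff hC.1.2.2 y v).2 hy, rfl⟩
  have hex : ∀ x, ∃ v, (x, v) ∈ C := fun x => by
    obtain ⟨⟨y, v⟩, hy, rfl⟩ : x ∈ Prod.fst '' C := hproj ▸ mem_univ x
    exact ⟨v, hy⟩
  choose φ hφ using hex
  have huniq : ∀ x v, (x, v) ∈ C → v = φ x := fun x v hv => by
    have := hstab _ (hC.mem_verticalStabilizer (hφ x) (s := v - φ x) (by simpa using hv))
    linarith
  have hcont : Continuous φ := by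
    rw [continuous_iff_isClosed]
    intro s hs
    have : φ ⁻¹' s = Prod.fst '' (C ∩ Prod.snd ⁻¹' s) := by
      ext x
      constructor
      · intro hx
        exact ⟨(x, φ x), ⟨hφ x, hx⟩, rfl⟩
      · rintro ⟨⟨y, v⟩, ⟨hy, hv⟩, rfl⟩
        have := huniq y v hy
        subst this
        exact hv
    rw [this]
    exact ((hcomp.inter_right (hs.preimage continuous_snd)).image continuous_fst).isClosed
  refine ⟨⟨φ, hcont⟩, fun x => ?_⟩
  exact (huniq _ _ ((skewTranslation_mem_iff hC.1.2.2 x (φ x)).2 (hφ x))).symm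

/-- The bounded orbit makes `C` compact, and the multiples of a nonzero vertical period would leave
any compact set. -/
theorem exists_invariant_section_of_bounded {α : ℝ} (hα : Irrational α)
    (hC : IsMinimalInvariantClosed (skewTranslation α ρ) C) {x : AddCircle (1 : ℝ)} {v K : ℝ}
    (hx : (x, v) ∈ C)
    (hK : ∀ n, |birkhoffSum (fun y => y + (α : AddCircle (1 : ℝ))) ρ n x| ≤ K) :
    ∃ φ : C(AddCircle (1 : ℝ), ℝ), ∀ x, φ (x + α) = φ x + ρ x := by
  have hcomp : IsCompact ((univ : Set (AddCircle (1 : ℝ))) ×ˢ Icc (v - K) (v + K)) :=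
    isCompact_univ.prod isCompact_Icc
  have hsub := hC.subset_of_forward_orbit hcomp hx fun n => by
    rw [skewTranslation_iterate]
    have := abs_le.1 (hK n)
    exact ⟨mem_univ _, by constructor <;> simp only <;> linarith⟩
  refine exists_invariant_section hα hC (hcomp.of_isClosed_subset hC.1.2.1 hsub) fun s hs => ?_
  by_contra hne
  obtain ⟨n, hn⟩ := exists_nat_gt (K / |s|)
  rw [div_lt_iff₀ (abs_pos.2 hne)] at hn
  have hmem := (hsub (((verticalStabilizer C).nsmul_mem hs n x v).2 hx)).2
  simp only [mem_Icc, nsmul_eq_mul] at hmem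
  have : |n * s| ≤ K := abs_le.2 ⟨by linarith, by linarith⟩
  rw [abs_mul, Nat.abs_cast] at this
  linarith

end

/-! ### The theorem for skew translations. -/

instance isProbabilityMeasure_volume_addCircle :
    MeasureTheory.IsProbabilityMeasure
      (MeasureTheory.volume : MeasureTheory.Measure (AddCircle (1 : ℝ))) :=
  ⟨by simp⟩

theorem ContinuousMap.integrable_addCircle (ρ : C(AddCircle (1 : ℝ), ℝ)) :
    MeasureTheory.Integrable ρ :=
  ρ.continuous.integrable_of_hasCompactSupport (HasCompactSupport.of_compactSpace _)

theorem continuous_birkhoffSum (a : AddCircle (1 : ℝ)) (ρ : C(AddCircle (1 : ℝ), ℝ)) (n : ℕ) :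
    Continuous (birkhoffSum (fun y => y + a) ρ n) := by
  refine continuous_finsetSum _ fun i _ => ρ.continuous.comp ?_
  exact (by fun_prop : Continuous fun y : AddCircle (1 : ℝ) => y + a).iterate i

/-- Birkhoff sums inherit mean zero by invariance of the measure; the intermediate value theorem
then gives a zero. -/
theorem exists_birkhoffSum_eq_zero (a : AddCircle (1 : ℝ)) {ρ : C(AddCircle (1 : ℝ), ℝ)}
    (h0 : ∫ y, ρ y = 0) (n : ℕ) : ∃ y, birkhoffSum (fun y => y + a) ρ n y = 0 := by
  have hS := continuous_birkhoffSum a ρ n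
  have hSi : MeasureTheory.Integrable (birkhoffSum (fun y => y + a) ρ n) :=
    (⟨_, hS⟩ : C(AddCircle (1 : ℝ), ℝ)).integrable_addCircle
  have hint : ∫ y, birkhoffSum (fun y => y + a) ρ n y = 0 := by
    simp only [birkhoffSum, iterate_add_right_apply]
    rw [MeasureTheory.integral_finsetSum]
    · refine Finset.sum_eq_zero fun i _ => ?_
      rw [MeasureTheory.integral_add_right_eq_self (fun y => ρ y), h0]
    · exact fun i _ => (ρ.comp ⟨fun y => y + i • a, by fun_prop⟩).integrable_addCircle
  obtain ⟨y, hy⟩ := MeasureTheory.exists_le_integral hSi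
  obtain ⟨z, hz⟩ := MeasureTheory.exists_integral_le hSi
  rw [hint] at hy hz
  exact mem_range_of_exists_le_of_exists_ge hS ⟨y, hy⟩ ⟨z, hz⟩

theorem isCompact_setOf_abs_mem_Icc (r R : ℝ) : IsCompact {s : ℝ | r ≤ |s| ∧ |s| ≤ R} := by
  refine (isCompact_closedBall (0 : ℝ) R).of_isClosed_subset
    (IsClosed.and (isClosed_le continuous_const continuous_abs)
      (isClosed_le continuous_abs continuous_const)) fun s hs => ?_
  simpa using hs.2

theorem coe_natCast_mul_sub_intCast (α : ℝ) (n : ℕ) (m : ℤ) :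
    ((n * α - m : ℝ) : AddCircle (1 : ℝ)) = n • (α : AddCircle (1 : ℝ)) := by
  have hm : ((m : ℝ) : AddCircle (1 : ℝ)) = 0 := (AddCircle.coe_eq_zero_iff 1).2 ⟨m, by simp⟩
  rw [AddCircle.coe_sub, hm, sub_zero, ← nsmul_eq_mul, AddCircle.coe_nsmul]

/-- If the Birkhoff sums of the mean zero function `ρ` are bounded along the denominators of good
approximations of `α` and `ρ` is not a coboundary, then the skew translation by `α` and `ρ` has no
proper minimal invariant closed set. -/
theorem not_exists_isMinimalInvariantClosed_skewTranslation {α : ℝ} (hα : Irrational α)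
    {ρ : C(AddCircle (1 : ℝ), ℝ)} (h0 : ∫ y, ρ y = 0)
    (hB : ∃ B : ℝ, 0 ≤ B ∧ ∀ (q : ℕ) (p : ℤ), 0 < q → IsCoprime p (q : ℤ) →
      q * |q * α - p| < 1 → ∀ x, |birkhoffSum (fun y => y + (α : AddCircle (1 : ℝ))) ρ q x| ≤ B)
    (hρ : ¬ ∃ φ : C(AddCircle (1 : ℝ), ℝ), ∀ x, φ (x + α) = φ x + ρ x) :
    ¬ ∃ C : Set (AddCircle (1 : ℝ) × ℝ),
      C ≠ univ ∧ IsMinimalInvariantClosed (skewTranslation α ρ) C := by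
  rintro ⟨C, hCu, hC⟩
  obtain ⟨⟨x, v⟩, hx⟩ := hC.1.1
  have hCi := hC.1.2.2
  have hunb : ¬ ∃ K, ∀ n, |birkhoffSum (fun y => y + (α : AddCircle (1 : ℝ))) ρ n x| ≤ K :=
    fun ⟨K, hK⟩ => hρ (exists_invariant_section_of_bounded hα hC hx hK)
  rcases (verticalStabilizer C).dense_or_cyclic with hd | ⟨c, hc⟩
  · apply hCu
    have hall : ∀ s, s ∈ verticalStabilizer C := fun s => by
      have : (verticalStabilizer C : Set ℝ) = univ :=
        (isClosed_verticalStabilizer hC).closure_eq ▸ hd.closure_eq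
      exact (Set.ext_iff.1 this s).2 trivial
    have hE : {y | (y, v) ∈ C} = univ := by
      refine eq_univ_of_forall_add_mem_iff hα ⟨x, hx⟩ (hC.1.2.1.preimage (by fun_prop)) fun y => ?_
      exact (hall (ρ y) _ v).symm.trans (skewTranslation_mem_iff hCi y v)
    refine eq_univ_of_forall fun ⟨y, w⟩ => ?_
    have hy : (y, v) ∈ C := (Set.ext_iff.1 hE y).2 trivial
    simpa using (hall (w - v) y v).2 hy
  have hmem : ∀ s, s ∈ verticalStabilizer C ↔ ∃ n : ℤ, n * c = s := fun s => by
    rw [hc, AddSubgroup.mem_closure_singleton]; simp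
  rcases eq_or_ne c 0 with rfl | hc0
  -- Trivial stabilizer: no nonzero height difference occurs over `x`, so any annulus of width `B`
  -- away from `0` serves.
  · obtain ⟨B, hB0, hB⟩ := hB
    obtain ⟨ε, hε, hgap⟩ := exists_forall_add_notMem hC.1.2.1 (isCompact_singleton (x := (x, v)))
      (isCompact_setOf_abs_mem_Icc 1 (1 + B)) (by
        rintro y w hy s hs hmem'
        obtain ⟨rfl, rfl⟩ : y = x ∧ w = v := by simpa using hy
        obtain ⟨n, hn⟩ := (hmem s).1 (hC.mem_verticalStabilizer hx hmem')
        rw [mul_zero] at hn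
        have := hs.1
        rw [← hn, abs_zero] at this
        linarith)
    obtain ⟨q, q', p, p', hq, hq', hc, hc', a1, a2, a3, a4, a5, a6⟩ :=
      exists_coprime_approx_two_sided hα hε
    refine hunb (exists_forall_abs_birkhoffSum_le ρ x one_pos hε.le hq hq' a3 a4.le a5 a6.le
      (hB q p hq hc a1) (hB q' p' hq' hc' a2) fun n m hnm hS => ?_)
    refine hgap _ hnm x v rfl _ hS ?_
    rw [coe_natCast_mul_sub_intCast]
    exact skewTranslation_iterate_mem hCi hx n
  · have hcpos : 0 < |c| := abs_pos.2 hc0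
    have habs : |c| ∈ verticalStabilizer C := by
      have hcm : c ∈ verticalStabilizer C := (hmem c).2 ⟨1, by simp⟩
      rcases abs_choice c with h | h
      · rwa [h]
      · rw [h]; exact neg_mem hcm
    -- `C` is periodic with vertical period `|c|`, so this compact piece represents it and makes the
    -- gap uniform over all fibres.
    have hQ : IsCompact (C ∩ univ ×ˢ Icc 0 |c|) :=
      (isCompact_univ.prod isCompact_Icc).inter_left hC.1.2.1
    -- Nonzero multiples of `c` have size at least `|c|`. The annulus has width `|c| / 4`, the step
    -- bound proved in `hsmall`.
    obtain ⟨ε, hε, hgap⟩ := exists_forall_add_notMem hC.1.2.1 hQ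
      (isCompact_setOf_abs_mem_Icc (|c| / 4) (|c| / 2)) (by
        rintro y w hy s ⟨hs1, hs2⟩ hmem'
        obtain ⟨n, rfl⟩ := (hmem s).1 (hC.mem_verticalStabilizer hy.1 hmem')
        rw [abs_mul] at hs1 hs2
        have h1 : |(n : ℝ)| ≤ 1 / 2 := le_of_mul_le_mul_right (by linarith) hcpos
        have h2 : n = 0 := by
          have : |(n : ℝ)| < 1 := by linarith
          rw [← Int.abs_lt_one_iff]
          exact_mod_cast this
        rw [h2] at hs1
        simp only [Int.cast_zero, abs_zero, zero_mul] at hs1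
        linarith)
    have hfib : ∀ y, ∃ w, (y, w) ∈ C ∩ univ ×ˢ Icc 0 |c| := by
      have hE : Prod.fst '' (C ∩ univ ×ˢ Icc 0 |c|) = {y | ∃ w, (y, w) ∈ C} := by
        ext y
        constructor
        · rintro ⟨⟨_, w⟩, hw, rfl⟩
          exact ⟨w, hw.1⟩
        · rintro ⟨w, hw⟩
          refine ⟨(y, toIcoMod hcpos 0 w), ⟨?_, mem_univ _, ?_⟩, rfl⟩
          · rw [← self_sub_toIcoDiv_zsmul, sub_eq_add_neg]
            exact (neg_mem (zsmul_mem habs _) y w).2 hw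
          · simpa using Ico_subset_Icc_self (toIcoMod_mem_Ico hcpos 0 w)
      have huniv := eq_univ_of_forall_add_mem_iff hα (E := {y | ∃ w, (y, w) ∈ C}) ⟨x, v, hx⟩
        (hE ▸ (hQ.image continuous_fst).isClosed) fun y => by
          constructor
          · rintro ⟨w, hw⟩
            exact ⟨w - ρ y, (skewTranslation_mem_iff hCi _ _).1 (by simpa using hw)⟩
          · rintro ⟨w, hw⟩
            exact ⟨_, (skewTranslation_mem_iff hCi _ _).2 hw⟩
      intro y
      obtain ⟨⟨_, w⟩, hw, rfl⟩ : y ∈ Prod.fst '' (C ∩ univ ×ˢ Icc 0 |c|) := by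
        rw [hE, huniv]; trivial
      exact ⟨w, hw⟩
    have hgap' : ∀ (y : AddCircle (1 : ℝ)) (n : ℕ) (m : ℤ), |n * α - m| ≤ ε →
        ¬ (|c| / 4 ≤ |birkhoffSum (fun y => y + (α : AddCircle (1 : ℝ))) ρ n y| ∧
          |birkhoffSum (fun y => y + (α : AddCircle (1 : ℝ))) ρ n y| ≤ |c| / 2) := by
      intro y n m hnm hS
      obtain ⟨w, hw⟩ := hfib y
      refine hgap _ hnm y w hw _ hS ?_
      rw [coe_natCast_mul_sub_intCast]
      exact skewTranslation_iterate_mem hCi hw.1 n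
    -- The sum vanishes somewhere, so a value above `|c| / 4` would force the value `|c| / 4`,
    -- inside the gap, at some point.
    have hsmall : ∀ (n : ℕ) (m : ℤ), |n * α - m| ≤ ε →
        ∀ y, |birkhoffSum (fun y => y + (α : AddCircle (1 : ℝ))) ρ n y| ≤ |c| / 4 := by
      intro n m hnm y
      by_contra! hlt
      obtain ⟨z, hz⟩ := exists_birkhoffSum_eq_zero (α : AddCircle (1 : ℝ)) h0 n
      obtain ⟨u, hu⟩ := mem_range_of_exists_le_of_exists_ge
        (continuous_birkhoffSum (α : AddCircle (1 : ℝ)) ρ n).abs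
        (c := |c| / 4) ⟨z, by rw [hz, abs_zero]; positivity⟩ ⟨y, hlt.le⟩
      exact hgap' u n m hnm ⟨hu.ge, hu.le.trans (by linarith)⟩
    obtain ⟨q, q', p, p', hq, hq', -, -, -, -, a3, a4, a5, a6⟩ :=
      exists_coprime_approx_two_sided hα hε
    refine hunb (exists_forall_abs_birkhoffSum_le ρ x (r := |c| / 4) (by positivity) hε.le hq hq'
      a3 a4.le a5 a6.le
      (hsmall q p (by rw [abs_of_nonneg a3]; exact a4.le))
      (hsmall q' p' (by rw [abs_of_nonpos a5]; linarith)) fun n m hnm hS => ?_)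
    exact hgap' x n m hnm ⟨hS.1, by linarith [hS.2]⟩

/-! ### Squares of homeomorphisms, skew reflections and the conclusion. -/

/-- A minimal invariant closed set of `f` contains one of `f ∘ f`. -/
theorem IsMinimalInvariantClosed.exists_subset_comp_self {Y : Type*} [TopologicalSpace Y]
    {f : Y ≃ₜ Y} {C : Set Y} (hC : IsMinimalInvariantClosed f C) :
    ∃ D ⊆ C, IsMinimalInvariantClosed (f ∘ f) D := by
  obtain ⟨⟨hne, hcl, hinv⟩, hmin⟩ := hC
  by_cases hC2 : ∀ D ⊆ C, D.Nonempty → IsClosed D → (f ∘ f) '' D = D → D = C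
  · exact ⟨C, Subset.rfl, ⟨hne, hcl, by rw [image_comp, hinv, hinv]⟩, hC2⟩
  push Not at hC2
  -- This `D` is itself minimal for `f ∘ f`: it is disjoint from `f '' D`, and any smaller candidate
  -- `E` satisfies `E ∪ f '' E = C`, so it must fill `D`.
  obtain ⟨D, hDC, hDne, hDcl, hDinv, hDne'⟩ := hC2
  have himage : ∀ E ⊆ C, f '' E ⊆ C := fun E hE => hinv ▸ image_mono hE
  have hunion : ∀ E ⊆ C, E.Nonempty → IsClosed E → (f ∘ f) '' E = E → E ∪ f '' E = C := by
    intro E hEC hEne hEcl hEinv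
    refine hmin _ (union_subset hEC (himage E hEC)) (hEne.mono subset_union_left)
      (hEcl.union (f.isClosedMap _ hEcl)) ?_
    rw [image_union, ← image_comp, hEinv, union_comm]
  have hdisj : D ∩ f '' D = ∅ := by
    by_contra hne'
    have h := hmin (D ∩ f '' D) (inter_subset_left.trans hDC) (nonempty_iff_ne_empty.2 hne')
      (hDcl.inter (f.isClosedMap _ hDcl)) (by
        rw [image_inter f.injective, ← image_comp, hDinv, inter_comm])
    exact hDne' (hDC.antisymm (h ▸ inter_subset_left))
  refine ⟨D, hDC, ⟨hDne, hDcl, hDinv⟩, fun E hED hEne hEcl hEinv => hED.antisymm fun y hy => ?_⟩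
  have hyC := hDC hy
  rw [← hunion E (hED.trans hDC) hEne hEcl hEinv] at hyC
  refine hyC.resolve_right fun hy' => ?_
  have : y ∈ D ∩ f '' D := ⟨hy, image_mono hED hy'⟩
  rw [hdisj] at this
  exact this

/-- The skew reflection `(x, v) ↦ (x + a, -v + ρ x)`. -/
def skewReflection (a : AddCircle (1 : ℝ)) (ρ : C(AddCircle (1 : ℝ), ℝ)) :
    AddCircle (1 : ℝ) × ℝ ≃ₜ AddCircle (1 : ℝ) × ℝ where
  toFun p := (p.1 + a, -p.2 + ρ p.1)
  invFun p := (p.1 - a, -(p.2 - ρ (p.1 - a)))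
  left_inv p := by simp
  right_inv p := by simp
  continuous_toFun := by fun_prop
  continuous_invFun := by fun_prop

theorem skewReflection_comp_self (a : AddCircle (1 : ℝ)) (ρ : C(AddCircle (1 : ℝ), ℝ)) :
    skewReflection a ρ ∘ skewReflection a ρ =
      skewTranslation (a + a) (ρ.comp ⟨fun x => x + a, by fun_prop⟩ - ρ) := by
  ext ⟨x, v⟩
  · exact add_assoc x a a
  · change -(-v + ρ x) + ρ (x + a) = v + (ρ (x + a) - ρ x)
    ring

theorem integral_sub_comp_add_right (a : AddCircle (1 : ℝ)) (ρ : C(AddCircle (1 : ℝ), ℝ)) :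
    ∫ y, (ρ.comp ⟨fun x => x + a, by fun_prop⟩ - ρ) y = 0 := by
  have h := MeasureTheory.integral_sub
    (ρ.comp ⟨fun x => x + a, by fun_prop⟩).integrable_addCircle ρ.integrable_addCircle
  refine h.trans (sub_eq_zero.2 ?_)
  exact MeasureTheory.integral_add_right_eq_self (fun y => ρ y) a

theorem birkhoffSum_sub_comp_add_right (a b : AddCircle (1 : ℝ)) (ρ : C(AddCircle (1 : ℝ), ℝ))
    (n : ℕ) (x : AddCircle (1 : ℝ)) :
    birkhoffSum (fun y => y + b) (ρ.comp ⟨fun x => x + a, by fun_prop⟩ - ρ) n x =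
      birkhoffSum (fun y => y + b) ρ n (x + a) - birkhoffSum (fun y => y + b) ρ n x := by
  simp only [birkhoffSum, iterate_add_right_apply, ← Finset.sum_sub_distrib]
  refine Finset.sum_congr rfl fun i _ => ?_
  change ρ (x + i • b + a) - ρ (x + i • b) = _
  rw [add_right_comm]

/-- Coboundaries have mean zero, and uniform limits preserve this. -/
theorem integral_eq_zero_of_tendstoUniformly {a : AddCircle (1 : ℝ)}
    {ρ : C(AddCircle (1 : ℝ), ℝ)} {φ : ℕ → C(AddCircle (1 : ℝ), ℝ)}
    (h : TendstoUniformly (fun k x => φ k (x + a) - φ k x) ρ atTop) : ∫ y, ρ y = 0 := by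
  refine abs_nonpos_iff.1 (le_of_forall_pos_le_add fun ε hε => ?_)
  obtain ⟨k, hk⟩ := (Metric.tendstoUniformly_iff.1 h ε hε).exists
  set ψ := (φ k).comp ⟨fun x => x + a, by fun_prop⟩ - φ k with hψ
  have hψ0 : ∫ y, ψ y = 0 := integral_sub_comp_add_right a (φ k)
  have hsub : ∫ y, ρ y = ∫ y, (ρ y - ψ y) := by
    rw [MeasureTheory.integral_sub ρ.integrable_addCircle ψ.integrable_addCircle, hψ0, sub_zero]
  rw [hsub, zero_add, ← Real.norm_eq_abs]
  have hle := MeasureTheory.norm_integral_le_of_norm_le_const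
    (μ := (MeasureTheory.volume : MeasureTheory.Measure (AddCircle (1 : ℝ))))
    (f := fun y => ρ y - ψ y) (C := ε) (Eventually.of_forall fun y => by
      rw [← dist_eq_norm]; exact (hk y).le)
  simpa using hle

theorem CylindricalVortex.eq_one_or_eq_neg_one {X : Type*} [TopologicalSpace X]
    [PreconnectedSpace X] (F : CylindricalVortex X) :
    (∀ x, (F.Ψ x : ℝ) = 1) ∨ ∀ x, (F.Ψ x : ℝ) = -1 := by
  have hc : Continuous fun x => (F.Ψ x : ℝ) := continuous_subtype_val.comp F.Ψ.continuous
  rcases isPreconnected_univ.eq_one_or_eq_neg_one_of_sq_eq hc.continuousOn (fun x _ => by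
    have := (Unitary.mem_iff.1 (F.Ψ x).2).1
    rw [star_trivial] at this
    simpa [sq] using this) with h | h
  · exact Or.inl fun x => h (mem_univ x)
  · exact Or.inr fun x => h (mem_univ x)

theorem mainTheorem4 (α : ℝ) (hα : Irrational α)
    (F : CylindricalVortex (AddCircle (1 : ℝ)))
    (hT : F.T = Homeomorph.addRight (α : AddCircle (1 : ℝ)))
    (hnr : ¬ F.IsReducible) (har : F.IsAlmostReducible)
    (hρ : HasFiniteTotalVariation F.ρ) :
    ¬ ∃ C : Set (AddCircle (1 : ℝ) × ℝ),
      C ≠ Set.univ ∧ IsMinimalInvariantClosed F.map C := by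
  have hTx : ∀ x, F.T x = x + (α : AddCircle (1 : ℝ)) := fun x => by rw [hT]; rfl
  rcases F.eq_one_or_eq_neg_one with hΨ | hΨ
  · have hmap : F.map = skewTranslation α F.ρ := by
      ext ⟨x, v⟩
      · exact hTx x
      · change (F.Ψ x : ℝ) * v + F.ρ x = v + F.ρ x
        rw [hΨ, one_mul]
    have h0 : ∫ y, F.ρ y = 0 := by
      obtain ⟨φ, hφ⟩ := har
      simp only [hTx, hΨ, one_mul] at hφ
      exact integral_eq_zero_of_tendstoUniformly hφ
    rw [hmap]
    refine not_exists_isMinimalInvariantClosed_skewTranslation hα h0 ?_ ?_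
    · obtain ⟨B, hB0, hB⟩ := denjoy_koksma α F.ρ.continuous hρ
      refine ⟨B, hB0, fun q p hq hpq hqp x => ?_⟩
      simpa [h0] using hB q p hq hpq hqp x
    · rintro ⟨φ, hφ⟩
      refine hnr ⟨φ, fun x => ?_⟩
      rw [hmap, hTx, hφ]
      rfl
  · have hmap : F.map = skewReflection α F.ρ := by
      ext ⟨x, v⟩
      · exact hTx x
      · change (F.Ψ x : ℝ) * v + F.ρ x = -v + F.ρ x
        rw [hΨ, neg_one_mul]
    rw [hmap]
    rintro ⟨C, hCu, hC⟩
    obtain ⟨D, hDC, hD⟩ := hC.exists_subset_comp_self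
    rw [skewReflection_comp_self, ← AddCircle.coe_add, ← two_mul] at hD
    have hα2 : Irrational (2 * α) := by exact_mod_cast hα.natCast_mul two_ne_zero
    refine not_exists_isMinimalInvariantClosed_skewTranslation hα2
      (integral_sub_comp_add_right _ F.ρ) ?_ ?_ ⟨D, ?_, hD⟩
    · obtain ⟨B, hB0, hB⟩ := denjoy_koksma (2 * α) F.ρ.continuous hρ
      -- The Birkhoff sum of the difference is a difference of two Birkhoff sums of `ρ`, in which
      -- the means cancel.
      refine ⟨B + B, by positivity, fun q p hq hpq hqp x => ?_⟩
      rw [birkhoffSum_sub_comp_add_right]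
      have h1 := abs_le.1 (hB q p hq hpq hqp x)
      have h2 := abs_le.1 (hB q p hq hpq hqp (x + α))
      rw [abs_le]
      constructor <;> linarith
    · rintro ⟨φ, hφ⟩
      -- The reflection exchanges the graph of `φ` and its image; being affine on fibres, it
      -- preserves their midpoint.
      refine hnr ⟨⟨fun x => (φ x + (-φ (x - α) + F.ρ (x - α))) / 2, by fun_prop⟩, fun x => ?_⟩
      have h := hφ (x - α)
      have e : x - (α : AddCircle (1 : ℝ)) + ((2 * α : ℝ) : AddCircle (1 : ℝ)) = x + α := by
        rw [two_mul, AddCircle.coe_add]; abel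
      rw [e] at h
      change φ (x + α) = φ (x - α) + (F.ρ (x - α + α) - F.ρ (x - α)) at h
      rw [sub_add_cancel] at h
      rw [hmap, hTx]
      ext
      · rfl
      · change -((φ x + (-φ (x - α) + F.ρ (x - α))) / 2) + F.ρ x =
          (φ (x + α) + (-φ (x + α - α) + F.ρ (x + α - α))) / 2
        rw [add_sub_cancel_right, h]
        ring
    · exact fun h => hCu (univ_subset_iff.1 (h ▸ hDC))
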